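/- **Theorem.** Let $G_2$ be the group of the $2\times2\times2$ Rubik's cube, i.e. the group of permutations of its $24$ stickers generated by the six clockwise quarter turns of the faces, and let $\phi : G_2\to S_8$ be the homomorphism that records the permutation of the eight corner positions. Let $\mathbb{Z}_{3,0}^8$ be the kernel of the sum map $\mathbb{Z}_3^8\to\mathbb{Z}_3$, and let $S_8$ act on it by permuting coordinates, $\sigma\cdot(a_1,\dots,a_8)=(a_{\sigma^{-1}(1)},\dots,a_{\sigma^{-1}(8)})$. For a field $F$ let $\mathrm{mdim}_F(G_2)$ denote the least dimension of a faithful finite-dimensional representation of $G_2$ over $F$. Let $\pi$ be the monomial representation of $\mathbb{Z}_{3,0}^8\rtimes S_8$ on $\mathbb{C}^8$ in which $a\in\mathbb{Z}_{3,0}^8$ acts by the diagonal matrix with entries $e^{2\pi i a_1/3},\dots,e^{2\pi i a_8/3}$ and $\sigma\in S_8$ acts by the permutation matrix $e_j\mapsto e_{\sigma(j)}$. Then: 1. There is an isomorphism $\varepsilon : G_2\to\mathbb{Z}_{3,0}^8\rtimes S_8$ whose $S_8$-component is $\phi$, and such that $\pi\circ\varepsilon$ is a faithful representation of $G_2$ of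 complex dimension $8$ and its restriction of scalars to $\mathbb{R}$ is a faithful representation of $G_2$ of real dimension $16$. 2. $\mathrm{mdim}_{\mathbb{C}}(G_2)=8$. 3. $\mathrm{mdim}_{\mathbb{R}}(G_2)=16$. In particular, a minimal faithful real representation of $G_2$ is obtained by restriction of scalars from a minimal faithful complex representation. -/

import Mathlib

namespace Rubik

/-! ### The 2 × 2 × 2 cube and its group -/

/-- The 24 stickers of the `2 × 2 × 2` cube.  A sticker place is a pair `(i, a)`, where
* `i` is a corner position, numbered `0, …, 7` in the order top-front-left, top-front-right,
  top-back-left, top-back-right, bottom-front-left, bottom-front-right, bottom-back-left,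
  bottom-back-right;
* `a` is the axis orthogonal to the face of the cube on which the sticker lies: `0` is the
  top–bottom axis, `1` the front–back axis, `2` the left–right axis.

Each corner position has exactly one sticker on each of the three axes. -/
abbrev Sticker : Type := Fin 8 × Fin 3

/-- The permutation of the stickers induced by a quarter turn, about the axis `a`, of the layer of
cubelets which are moved by the 4-cycle `c`.  Cubelets outside the layer do not move; the cubelet
at a position `i` of the layer goes to position `c i`, its sticker orthogonal to the axis `a` stays
orthogonal to `a`, and the quarter turn interchanges the two other axes. -/
def quarterTurn (c : Equiv.Perm (Fin 8)) (a : Fin 3) : Equiv.Perm Sticker where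
  toFun s := (c s.1, if c s.1 = s.1 then s.2 else Equiv.swap (a + 1) (a + 2) s.2)
  invFun s := (c.symm s.1, if c.symm s.1 = s.1 then s.2 else Equiv.swap (a + 1) (a + 2) s.2)
  left_inv := by
    rintro ⟨i, x⟩
    by_cases h : c i = i
    · simp [h, Equiv.symm_apply_eq]
    · simp [h, Ne.symm h]
  right_inv := by
    rintro ⟨i, x⟩
    by_cases h : c.symm i = i
    · have h' : c i = i := by rw [Equiv.symm_apply_eq] at h; exact h.symm
      simp [h, h']
    · simp [h, Ne.symm h]

/-- Top face, 90 degrees clockwise seen from above: `0 → 2 → 3 → 1 → 0`. -/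
def u : Equiv.Perm Sticker := quarterTurn (List.formPerm [0, 2, 3, 1]) 0

/-- Bottom face, 90 degrees clockwise seen from below. -/
def d : Equiv.Perm Sticker := quarterTurn (List.formPerm [4, 5, 7, 6]) 0

/-- Front face, 90 degrees clockwise seen from the front. -/
def f : Equiv.Perm Sticker := quarterTurn (List.formPerm [0, 1, 5, 4]) 1

/-- Back face, 90 degrees clockwise seen from behind. -/
def b : Equiv.Perm Sticker := quarterTurn (List.formPerm [2, 6, 7, 3]) 1

/-- Left face, 90 degrees clockwise seen from the left. -/
def l : Equiv.Perm Sticker := quarterTurn (List.formPerm [0, 4, 6, 2]) 2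

/-- Right face, 90 degrees clockwise seen from the right. -/
def r : Equiv.Perm Sticker := quarterTurn (List.formPerm [1, 3, 7, 5]) 2

/-- The group of the `2 × 2` cube: the group of permutations of the stickers generated by the six
face turns. -/
def G₂ : Subgroup (Equiv.Perm Sticker) := Subgroup.closure {u, d, f, b, l, r}

/-! ### The group `ℤ_{k,0}^m ⋊ S_m` -/

/-- `ℤ_{k,0}^m`: the kernel of the sum map `ℤ_k^m → ℤ_k`. -/
def ZeroSum (k m : ℕ) : AddSubgroup (Fin m → ZMod k) where
  carrier := {v | ∑ i, v i = 0}
  zero_mem' := by simp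
  add_mem' := by
    intro v w hv hw
    simp only [Set.mem_ofPred_eq] at hv hw
    simp [Finset.sum_add_distrib, hv, hw]
  neg_mem' := by
    intro v hv
    simp only [Set.mem_ofPred_eq] at hv
    simp [hv]

/-- The automorphism `(v_1, …, v_m) ↦ (v_{σ⁻¹(1)}, …, v_{σ⁻¹(m)})` of `ℤ_{k,0}^m`. -/
def permute (k m : ℕ) (σ : Equiv.Perm (Fin m)) : ZeroSum k m ≃+ ZeroSum k m where
  toFun v := ⟨fun i => v.1 (σ⁻¹ i), by
    have h : ∑ i, v.1 i = 0 := v.2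
    show ∑ i, v.1 (σ⁻¹ i) = 0
    rw [Equiv.sum_comp σ⁻¹ v.1, h]⟩
  invFun v := ⟨fun i => v.1 (σ i), by
    have h : ∑ i, v.1 i = 0 := v.2
    show ∑ i, v.1 (σ i) = 0
    rw [Equiv.sum_comp σ v.1, h]⟩
  left_inv v := by ext i; simp
  right_inv v := by ext i; simp
  map_add' _ _ := rfl

/-- The action of `S_m` on `ℤ_{k,0}^m` (written multiplicatively) by permuting coordinates. -/
def permAction (k m : ℕ) : Equiv.Perm (Fin m) →* MulAut (Multiplicative (ZeroSum k m)) where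
  toFun σ := AddEquiv.toMultiplicative (permute k m σ)
  map_one' := rfl
  map_mul' _ _ := rfl

/-- The semidirect product `ℤ_{k,0}^m ⋊ S_m`. -/
abbrev ZeroSumSemidirect (k m : ℕ) : Type :=
  Multiplicative (ZeroSum k m) ⋊[permAction k m] Equiv.Perm (Fin m)

/-! ### Representations -/

/-- The set of dimensions of the faithful finite-dimensional representations of `G` over `F`.
Its least element is `mdim_F(G)`. -/
def faithfulDims (F G : Type) [Field F] [Group G] : Set ℕ :=
  {n | ∃ (V : Type) (_ : AddCommGroup V) (_ : Module F V) (_ : FiniteDimensional F V)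
    (ρ : Representation F G V), Function.Injective ρ ∧ Module.finrank F V = n}

/-- Restriction of scalars of a complex representation to the real numbers. -/
def restrictToReal {G V : Type} [Group G] [AddCommGroup V] [Module ℂ V] [Module ℝ V]
    [IsScalarTower ℝ ℂ V] (ρ : Representation ℂ G V) : Representation ℝ G V where
  toFun g := (ρ g).restrictScalars ℝ
  map_one' := by ext v; simp
  map_mul' g h := by ext v; simp

/-- The `m`-dimensional complex monomial representation of `ℤ_{k,0}^m ⋊ S_m`: the tuple `a` acts
by the diagonal matrix with entries `exp (2 π i a_j / k)` and `σ ∈ S_m` acts by the permutation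
matrix `e_j ↦ e_{σ j}`, so that `(a, σ) = a σ` sends `v` to the vector with `j`-th coordinate
`exp (2 π i a_j / k) v_{σ⁻¹ j}`. -/
noncomputable def monomialRep (k m : ℕ) [NeZero k] :
    Representation ℂ (ZeroSumSemidirect k m) (Fin m → ℂ) where
  toFun g :=
    { toFun := fun v j =>
        ZMod.stdAddChar ((Multiplicative.toAdd g.left).1 j) * v (g.right⁻¹ j)
      map_add' := by intro v w; ext j; simp [mul_add]
      map_smul' := by intro c v; ext j; simp [mul_left_comm] }
  map_one' := by
    refine LinearMap.ext fun v => funext fun j => ?_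
    simp
  map_mul' g h := by
    refine LinearMap.ext fun v => funext fun j => ?_
    have key : (Multiplicative.toAdd (g * h).left).1 j =
        (Multiplicative.toAdd g.left).1 j + (Multiplicative.toAdd h.left).1 (g.right⁻¹ j) := rfl
    have key' : (g * h).right⁻¹ j = h.right⁻¹ (g.right⁻¹ j) := by
      simp [mul_inv_rev]
    simp only [LinearMap.coe_mk, AddHom.coe_mk, Module.End.mul_apply, key, key',
      AddChar.map_add_eq_mul, mul_assoc]

end Rubik

/-!
The group of the cube is `ℤ_{3,0}^8 ⋊ S_8`.  In suitable coordinates on the stickers of each corner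
a quarter turn moves the corners and adds twists with sum zero, so the semidirect product acts
faithfully on the stickers (`stickerAction`) by a group which contains the six turns.  The turns
generate it (`closure_range_turn`): words in them give an 8-cycle and an adjacent transposition of
the corners, hence all of `S_8`, and one word is a pure twist whose conjugates generate
`ℤ_{3,0}^8`.  The monomial representation is faithful because its matrices show the permutation and
the diagonal entries, so the two upper bounds follow.

For the lower bounds, let the twists `t_i = e_i + (1, …, 1)`, `i = 1, …, 8`, act on a faithful
complex representation.  They commute, have order three and product one, and `S_8` permutes them.
Hence the space has a basis of common eigenvectors, and the families `(χ_1, …, χ_8)` of eigenvalues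
occurring there, the weights, consist of cube roots of unity with product one and form a set stable
under permutations.  The dimension is at least the number of weights.  As `t_1` does not act
trivially, some weight `χ` is not identically one, and it cannot be constant, since `c³ = c⁸ = 1`
forces `c = 1`.  By pigeonhole some value is taken by `χ` exactly `k` times with `3 ≤ k ≤ 7`, so `χ`
has at least `C(8, k) ≥ 8` rearrangements (`exists_eight_rearrangements`).

In the complexification of a real representation the weights are also stable under complex
conjugation.  If `k ≤ 6`, the rearrangements already number `C(8, k) ≥ 28`.  If `k = 7`, then `χ` is
`x` seven times and `x⁻¹` once; its conjugate is not a rearrangement of it and contributes eight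
further weights (`exists_sixteen_rearrangements`).
-/

open scoped TensorProduct

namespace Rubik

/-! ### The isomorphism of `G₂` with `ℤ_{3,0}^8 ⋊ S_8` -/

/-- The sign (`1` or `-1 = 2`) of a corner position in the checkerboard colouring of the vertices
of the cube: adjacent corners have opposite signs. -/
def cornerSign : Fin 8 → ZMod 3 := ![1, 2, 2, 1, 2, 1, 1, 2]

theorem cornerSign_mul_cancel (i : Fin 8) (x : ZMod 3) :
    cornerSign i * (cornerSign i * x) = x := by
  revert i x; decide

/-- The map of the stickers defined by an element of `ℤ_{3,0}^8 ⋊ S_8`.  At the position `i` the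
sticker on the axis `x` gets the coordinate `cornerSign i * x`, so that the three stickers of each
corner are cyclically ordered in the same sense, seen from outside the cube.  In this coordinate,
`(a, σ)` moves the corner `i` to `σ i` and adds the twist `a (σ i)`. -/
def moveSticker (g : ZeroSumSemidirect 3 8) (s : Sticker) : Sticker :=
  (g.right s.1, (ZMod.finEquiv 3).symm (cornerSign (g.right s.1) *
    (cornerSign s.1 * ZMod.finEquiv 3 s.2 + (Multiplicative.toAdd g.left).1 (g.right s.1))))

/-- The action of `ℤ_{3,0}^8 ⋊ S_8` on the stickers by `moveSticker`. -/
def stickerAction : ZeroSumSemidirect 3 8 →* Equiv.Perm Sticker :=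
  MonoidHom.toHomPerm
    { toFun := moveSticker
      map_one' := by
        funext ⟨i, x⟩
        refine Prod.ext rfl ?_
        have key : (Multiplicative.toAdd (1 : ZeroSumSemidirect 3 8).left).1 i = 0 := rfl
        change (ZMod.finEquiv 3).symm (cornerSign i * (cornerSign i * ZMod.finEquiv 3 x +
          (Multiplicative.toAdd (1 : ZeroSumSemidirect 3 8).left).1 i)) = x
        rw [key, add_zero, cornerSign_mul_cancel, RingEquiv.symm_apply_apply]
      map_mul' := fun g h => by
        funext ⟨i, x⟩
        refine Prod.ext rfl ?_
        have key : (Multiplicative.toAdd (g * h).left).1 (g.right (h.right i)) =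
            (Multiplicative.toAdd g.left).1 (g.right (h.right i)) +
              (Multiplicative.toAdd h.left).1 (g.right⁻¹ (g.right (h.right i))) := rfl
        rw [Equiv.Perm.inv_def, Equiv.symm_apply_apply] at key
        change (moveSticker (g * h) (i, x)).2 = (moveSticker g (moveSticker h (i, x))).2
        simp only [moveSticker, SemidirectProduct.mul_right, Equiv.Perm.mul_apply, key,
          cornerSign_mul_cancel, RingEquiv.apply_symm_apply]
        congr 2
        ring }

theorem stickerAction_apply (g : ZeroSumSemidirect 3 8) (s : Sticker) :
    stickerAction g s = moveSticker g s := rfl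

theorem stickerAction_injective : Function.Injective stickerAction := by
  intro g h hgh
  have key (i : Fin 8) : moveSticker g (i, 0) = moveSticker h (i, 0) := congr($hgh (i, 0))
  have hright : g.right = h.right := Equiv.ext fun i => congrArg Prod.fst (key i)
  refine SemidirectProduct.ext (Subtype.ext (funext fun j => ?_)) hright
  have h2 := congrArg (cornerSign j * ZMod.finEquiv 3 ·.2) (key (g.right.symm j))
  change (Multiplicative.toAdd g.left).1 j = (Multiplicative.toAdd h.left).1 j
  simpa [moveSticker, ← hright, cornerSign_mul_cancel] using h2

/-- The element of `ℤ_{3,0}^8 ⋊ S_8` with the given twists and the given permutation. -/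
def twistPerm (v : Fin 8 → ZMod 3) (hv : ∑ i, v i = 0) (σ : Equiv.Perm (Fin 8)) :
    ZeroSumSemidirect 3 8 :=
  ⟨Multiplicative.ofAdd ⟨v, hv⟩, σ⟩

/-- The six quarter turns as elements of `ℤ_{3,0}^8 ⋊ S_8`, in the order `u, d, f, b, l, r`.  A turn
about the axis `a` fixes `a` and interchanges the other two axes, so it is `x ↦ 2 * a - x` on axes.
As it also moves the corner `i` to one of opposite sign, it adds the twist `cornerSign i * a` to the
coordinate `cornerSign i * x` of the stickers. -/
def turn : Fin 6 → ZeroSumSemidirect 3 8 :=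
  ![twistPerm ![0, 0, 0, 0, 0, 0, 0, 0] (by decide) (List.formPerm [0, 2, 3, 1]),
    twistPerm ![0, 0, 0, 0, 0, 0, 0, 0] (by decide) (List.formPerm [4, 5, 7, 6]),
    twistPerm ![2, 1, 0, 0, 1, 2, 0, 0] (by decide) (List.formPerm [0, 1, 5, 4]),
    twistPerm ![0, 0, 1, 2, 0, 0, 2, 1] (by decide) (List.formPerm [2, 6, 7, 3]),
    twistPerm ![1, 0, 2, 0, 2, 0, 1, 0] (by decide) (List.formPerm [0, 4, 6, 2]),
    twistPerm ![0, 2, 0, 1, 0, 1, 0, 2] (by decide) (List.formPerm [1, 3, 7, 5])]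

theorem stickerAction_turn (k : Fin 6) : stickerAction (turn k) = ![u, d, f, b, l, r] k := by
  revert k
  decide +kernel

/-- The quarter turns permute the corner positions as the whole symmetric group: the word `u²d²f`
gives an 8-cycle, and `(ufl)⁵` gives a transposition of two positions adjacent in it. -/
theorem map_rightHom_closure_turn :
    (Subgroup.closure (Set.range turn)).map SemidirectProduct.rightHom = ⊤ := by
  have hmem (k : Fin 6) : (turn k).right ∈
      (Subgroup.closure (Set.range turn)).map SemidirectProduct.rightHom :=
    ⟨turn k, Subgroup.subset_closure ⟨k, rfl⟩, rfl⟩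
  let σ : Equiv.Perm (Fin 8) := List.formPerm [0, 2, 1, 6, 5, 7, 4, 3]
  have hσ : σ.IsCycle := List.isCycle_formPerm (by decide) (by decide)
  have hsupp : σ.support = Finset.univ := by decide
  rw [eq_top_iff, ← Equiv.Perm.closure_cycle_adjacent_swap hσ hsupp 0, Subgroup.closure_le]
  rintro τ (rfl | rfl)
  · have h : σ = (turn 0).right * (turn 0).right * (turn 1).right * (turn 1).right *
        (turn 2).right := by decide +kernel
    rw [h]
    exact mul_mem (mul_mem (mul_mem (mul_mem (hmem 0) (hmem 0)) (hmem 1)) (hmem 1)) (hmem 2)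
  · have h : Equiv.swap 0 (σ 0) =
        ((turn 0).right * (turn 2).right * (turn 4).right) ^ 5 := by decide +kernel
    rw [h]
    exact pow_mem (mul_mem (mul_mem (hmem 0) (hmem 2)) (hmem 4)) 5

/-- The vector `e_i + (1, …, 1)`.  Its entries have the sum `1 + 8 = 0` in `ℤ_3`; it is the
projection of `e_i` to `ℤ_{3,0}^8` along the constant vectors.  The twists `twist i` generate
`ℤ_{3,0}^8` and are permuted by `S_8` like the corner positions. -/
def twist (i : Fin 8) : ZeroSum 3 8 :=
  ⟨fun j => if j = i then 2 else 1, by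
    change ∑ j, (if j = i then (2 : ZMod 3) else 1) = 0
    revert i; decide⟩

theorem permAction_twist (σ : Equiv.Perm (Fin 8)) (i : Fin 8) :
    permAction 3 8 σ (Multiplicative.ofAdd (twist i)) = Multiplicative.ofAdd (twist (σ i)) := by
  refine Subtype.ext (funext fun j => ?_)
  change (if σ⁻¹ j = i then (2 : ZMod 3) else 1) = if j = σ i then 2 else 1
  simp only [Equiv.Perm.inv_eq_iff_eq]

theorem sum_val_smul_twist (v : ZeroSum 3 8) : ∑ i, (v.1 i).val • twist i = v := by
  have hv : ∑ i, v.1 i = 0 := v.2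
  refine Subtype.ext (funext fun j => ?_)
  have h (i : Fin 8) : (twist i).1 j = 1 + if i = j then 1 else 0 := by
    revert i j; decide
  have hsum : (∑ i, (v.1 i).val • twist i).1 j = ∑ i, v.1 i * (twist i).1 j := by
    rw [AddSubgroup.val_finsetSum, Finset.sum_apply]
    refine Finset.sum_congr rfl fun i _ => ?_
    change (v.1 i).val • (twist i).1 j = _
    rw [nsmul_eq_mul, ZMod.natCast_zmod_val]
  rw [hsum]
  simp [h, mul_add, Finset.sum_add_distrib, hv]

/-- The quarter turns generate `ℤ_{3,0}^8 ⋊ S_8`.  The element `(u²df)⁷` is the pure twist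
`-twist 5`, and its conjugates generate `ℤ_{3,0}^8`. -/
theorem closure_range_turn : Subgroup.closure (Set.range turn) = ⊤ := by
  set H := Subgroup.closure (Set.range turn) with hH
  have hturn (k : Fin 6) : turn k ∈ H := Subgroup.subset_closure ⟨k, rfl⟩
  have hsurj (σ : Equiv.Perm (Fin 8)) : ∃ h ∈ H, h.right = σ := by
    have : σ ∈ H.map SemidirectProduct.rightHom := by rw [map_rightHom_closure_turn]; trivial
    exact this
  have hinl : ∀ v : Multiplicative (ZeroSum 3 8), SemidirectProduct.inl v ∈ H := by
    have h5 : SemidirectProduct.inl (Multiplicative.ofAdd (twist 5)) ∈ H := by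
      have h : (SemidirectProduct.inl (Multiplicative.ofAdd (twist 5)) : ZeroSumSemidirect 3 8) =
          ((turn 0 * turn 0 * turn 1 * turn 2) ^ 7)⁻¹ :=
        SemidirectProduct.ext (Subtype.ext (funext (by decide +kernel))) (by decide +kernel)
      rw [h]
      exact inv_mem (pow_mem (mul_mem (mul_mem (mul_mem (hturn 0) (hturn 0)) (hturn 1))
        (hturn 2)) 7)
    have htwist (i : Fin 8) : SemidirectProduct.inl (Multiplicative.ofAdd (twist i)) ∈ H := by
      obtain ⟨h, hh, hσ⟩ := hsurj (Equiv.swap 5 i)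
      have hconj : (SemidirectProduct.inl (Multiplicative.ofAdd (twist i)) :
          ZeroSumSemidirect 3 8) =
          h * SemidirectProduct.inl (Multiplicative.ofAdd (twist 5)) * h⁻¹ := by
        rw [eq_mul_inv_iff_mul_eq]
        refine SemidirectProduct.ext ?_ (by simp)
        simp [hσ, permAction_twist, mul_comm]
      rw [hconj]
      exact mul_mem (mul_mem hh h5) (inv_mem hh)
    intro v
    have hv := sum_val_smul_twist (Multiplicative.toAdd v)
    let K : AddSubgroup (ZeroSum 3 8) := Subgroup.toAddSubgroup' (H.comap SemidirectProduct.inl)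
    have hK (i : Fin 8) : twist i ∈ K := htwist i
    have hmem : Multiplicative.toAdd v ∈ K := by
      rw [← hv]
      exact sum_mem fun i _ => nsmul_mem (hK i) _
    exact hmem
  refine eq_top_iff.2 fun g _ => ?_
  obtain ⟨h, hh, hσ⟩ := hsurj g.right
  have hg : g = SemidirectProduct.inl (g.left * h.left⁻¹) * h :=
    SemidirectProduct.ext (by simp) (by simp [hσ])
  rw [hg]
  exact mul_mem (hinl _) hh

theorem range_stickerAction : stickerAction.range = G₂ := by
  rw [MonoidHom.range_eq_map, ← closure_range_turn, MonoidHom.map_closure, ← Set.range_comp, G₂]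
  congr 1
  have h : stickerAction ∘ turn = ![u, d, f, b, l, r] := funext stickerAction_turn
  rw [h]
  ext x
  simp [Matrix.range_cons]
  tauto

/-- The isomorphism of the group of the cube with `ℤ_{3,0}^8 ⋊ S_8`. -/
noncomputable def cubeEquiv : G₂ ≃* ZeroSumSemidirect 3 8 :=
  ((MonoidHom.ofInjective stickerAction_injective).trans
    (MulEquiv.subgroupCongr range_stickerAction)).symm

theorem cubeEquiv_right (g : G₂) (s : Sticker) : (g.1 s).1 = (cubeEquiv g).right s.1 := by
  obtain ⟨h, rfl⟩ := cubeEquiv.symm.surjective g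
  rw [MulEquiv.apply_symm_apply]
  rfl

/-! ### Weights of commuting operators -/

/-- The weights of a family of operators: the families of scalars which are the eigenvalues of the
operators at some common eigenvector. -/
def weights {ι K V : Type*} [Field K] [AddCommGroup V] [Module K V] (T : ι → Module.End K V) :
    Set (ι → K) :=
  {χ | ∃ v : V, v ≠ 0 ∧ ∀ i, T i v = χ i • v}

theorem pow_eq_one_of_mem_weights {ι K V : Type*} [Field K] [AddCommGroup V]
    [Module K V] {T : ι → Module.End K V} {χ : ι → K} (hχ : χ ∈ weights T)
    {n : ℕ} {i : ι} (hT : T i ^ n = 1) : χ i ^ n = 1 := by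
  obtain ⟨v, hv0, hv⟩ := hχ
  have h : (T i ^ n) v = χ i ^ n • v := by
    clear hT
    induction n with
    | zero => simp
    | succ n ih => rw [pow_succ', Module.End.mul_apply, ih, map_smul, hv, smul_smul, pow_succ]
  rw [hT, Module.End.one_apply] at h
  exact (smul_left_injective K hv0 (by simpa using h)).symm

section Weights

variable {ι K V : Type*} [Field K] [AddCommGroup V] [Module K V] [FiniteDimensional K V]
  {T : ι → Module.End K V}

theorem card_le_finrank_of_subset_weights (hcomm : ∀ i j, Commute (T i) (T j))
    (s : Finset (ι → K)) (hs : ↑s ⊆ weights T) : s.card ≤ Module.finrank K V := by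
  have hind := Module.End.independent_iInf_maxGenEigenspace_of_forall_mapsTo T
    fun i j φ => Module.End.mapsTo_maxGenEigenspace_of_comm (hcomm j i) φ
  choose v hv0 hv using fun χ : s => hs χ.2
  have hlin : LinearIndependent K v := by
    refine (hind.comp Subtype.val_injective).linearIndependent _ (fun χ => ?_) hv0
    refine (Submodule.mem_iInf _).2 fun i => ?_
    exact (T i).genEigenspace (χ.1 i) |>.monotone le_top
      (Module.End.mem_eigenspace_iff.2 (hv χ i))
  simpa using hlin.fintype_card_le_finrank

/-- Commuting operators of finite order over an algebraically closed field of characteristic `0` are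
simultaneously diagonalizable, so that an operator in the family other than `1` has an eigenvalue
other than `1` at some common eigenvector. -/
theorem exists_mem_weights_apply_ne_one [IsAlgClosed K] [CharZero K]
    (hcomm : ∀ i j, Commute (T i) (T j)) {n : ℕ} (hn : n ≠ 0) (hT : ∀ i, T i ^ n = 1) {j : ι}
    (hj : T j ≠ 1) : ∃ χ ∈ weights T, χ j ≠ 1 := by
  have hss (i : ι) : (T i).IsSemisimple := by
    refine Module.End.isSemisimple_of_squarefree_aeval_eq_zero
      (p := Polynomial.X ^ n - Polynomial.C 1) ?_ (by simp [hT i])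
    exact (Polynomial.separable_X_pow_sub_C (1 : K) (by exact_mod_cast hn) one_ne_zero).squarefree
  have htop := Module.End.iSup_iInf_maxGenEigenspace_eq_top_of_forall_mapsTo T
    (fun i j φ => Module.End.mapsTo_maxGenEigenspace_of_comm (hcomm j i) φ)
    fun i => Module.End.iSup_maxGenEigenspace_eq_top _
  simp_rw [fun i μ => (hss i).isFinitelySemisimple.maxGenEigenspace_eq_eigenspace μ] at htop
  by_contra! hcon
  refine hj (LinearMap.ext fun v => ?_)
  have hle : (⨆ χ : ι → K, ⨅ i, (T i).eigenspace (χ i)) ≤ (T j).eigenspace 1 := by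
    refine iSup_le fun χ v hv => ?_
    rw [Submodule.mem_iInf] at hv
    by_cases hv0 : v = 0
    · simp [hv0]
    · have h1 := hcon χ ⟨v, hv0, fun i => Module.End.mem_eigenspace_iff.1 (hv i)⟩
      exact h1 ▸ hv j
  have := hle (htop ▸ Submodule.mem_top : v ∈ _)
  simpa [Module.End.mem_eigenspace_iff] using this

end Weights

/-! ### Counting the rearrangements of a function -/

theorem exists_perm_mem_iff {α : Type*} [Fintype α] [DecidableEq α] {A B : Finset α}
    (h : A.card = B.card) : ∃ σ : Equiv.Perm α, ∀ i, σ i ∈ B ↔ i ∈ A := by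
  let e : {x // x ∈ A} ≃ {x // x ∈ B} := Finset.equivOfCardEq h
  refine ⟨e.extendSubtype, fun i => ⟨fun hi => ?_, fun hi => e.extendSubtype_mem i hi⟩⟩
  by_contra hi'
  exact e.extendSubtype_not_mem i hi' hi

/-- The rearrangements of `χ` realize every subset with as many elements as the fibre of `χ` over
`x` as a fibre over `x`. -/
theorem exists_finset_rearrangements {α β : Type*} [Fintype α] [DecidableEq α] [DecidableEq β]
    {W : Set (α → β)} (hW : ∀ χ ∈ W, ∀ σ : Equiv.Perm α, χ ∘ σ ∈ W) {χ : α → β} (hχ : χ ∈ W)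
    (x : β) {k : ℕ} (hk : (Finset.univ.filter (χ · = x)).card = k) :
    ∃ s : Finset (α → β), ↑s ⊆ W ∧ s.card = (Fintype.card α).choose k ∧
      ∀ ψ ∈ s, (Finset.univ.filter (ψ · = x)).card = k := by
  have key (A : Finset α) : ∃ ψ : α → β, A ∈ Finset.powersetCard k Finset.univ →
      ψ ∈ W ∧ Finset.univ.filter (ψ · = x) = A := by
    by_cases hA : A ∈ Finset.powersetCard k Finset.univ
    swap
    · exact ⟨χ, fun h => absurd h hA⟩
    obtain ⟨σ, hσ⟩ := exists_perm_mem_iff ((Finset.mem_powersetCard.1 hA).2.trans hk.symm)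
    refine ⟨χ ∘ σ, fun _ => ⟨hW χ hχ σ, Finset.ext fun i => ?_⟩⟩
    simpa using hσ i
  choose ψ hψ using key
  refine ⟨(Finset.powersetCard k Finset.univ).image ψ, ?_, ?_, ?_⟩
  · intro φ hφ
    obtain ⟨A, hA, rfl⟩ := Finset.mem_image.1 hφ
    exact (hψ A hA).1
  · rw [Finset.card_image_of_injOn, Finset.card_powersetCard, Finset.card_univ]
    intro A hA B hB hAB
    rw [← (hψ A hA).2, ← (hψ B hB).2]
    simp only [hAB]
  · intro φ hφ
    obtain ⟨A, hA, rfl⟩ := Finset.mem_image.1 hφ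
    rw [(hψ A hA).2]
    exact (Finset.mem_powersetCard.1 hA).2

/-- If eight cube roots of unity with product `1` are not all `1`, then some value is taken at
least three and at most seven times.  (The value `c` of a constant family would satisfy
`c ^ 3 = c ^ 8 = 1`.) -/
theorem exists_card_fiber {χ : Fin 8 → ℂ} (h3 : ∀ i, χ i ^ 3 = 1) (hprod : ∏ i, χ i = 1)
    {j : Fin 8} (hj : χ j ≠ 1) : ∃ x, x ^ 3 = 1 ∧
      3 ≤ (Finset.univ.filter (χ · = x)).card ∧ (Finset.univ.filter (χ · = x)).card ≤ 7 := by
  have hroots : (Polynomial.nthRootsFinset 3 (1 : ℂ)).card ≤ 3 :=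
    (Multiset.toFinset_card_le _).trans (Polynomial.card_nthRoots 3 1)
  obtain ⟨x, hx, hcard⟩ := Finset.exists_lt_card_fiber_of_mul_lt_card_of_maps_to
    (s := Finset.univ) (t := Polynomial.nthRootsFinset 3 (1 : ℂ)) (f := χ) (n := 2)
    (fun i _ => (Polynomial.mem_nthRootsFinset (by norm_num) 1).2 (h3 i))
    (by rw [Finset.card_univ, Fintype.card_fin]; omega)
  have hx3 := (Polynomial.mem_nthRootsFinset (by norm_num) 1).1 hx
  refine ⟨x, hx3, hcard, ?_⟩
  by_contra hlt
  have huniv : Finset.univ.filter (χ · = x) = Finset.univ := by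
    refine Finset.eq_univ_of_card _ ((Finset.card_le_univ _).antisymm ?_)
    rw [Fintype.card_fin]
    omega
  have hall (i : Fin 8) : χ i = x := by
    have : i ∈ Finset.univ.filter (χ · = x) := by rw [huniv]; exact Finset.mem_univ i
    simpa using this
  simp only [hall, Finset.prod_const, Finset.card_univ, Fintype.card_fin] at hprod
  refine hj ((hall j).trans ?_)
  linear_combination (x ^ 6 + x ^ 3 + 1) * hx3 - x * hprod

theorem eight_le_choose {k : ℕ} (h1 : 1 ≤ k) (h7 : k ≤ 7) : 8 ≤ (8).choose k := by
  interval_cases k <;> decide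

theorem sixteen_le_choose {k : ℕ} (h2 : 2 ≤ k) (h6 : k ≤ 6) : 16 ≤ (8).choose k := by
  interval_cases k <;> decide

/-- Some value of `χ` is taken `k` times with `3 ≤ k ≤ 7`, which leaves `C(8, k) ≥ 8`
rearrangements. -/
theorem exists_eight_rearrangements {W : Set (Fin 8 → ℂ)}
    (hW : ∀ χ ∈ W, ∀ σ : Equiv.Perm (Fin 8), χ ∘ σ ∈ W)
    {χ : Fin 8 → ℂ} (hχ : χ ∈ W) (h3 : ∀ i, χ i ^ 3 = 1) (hprod : ∏ i, χ i = 1)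
    {j : Fin 8} (hj : χ j ≠ 1) : ∃ s : Finset (Fin 8 → ℂ), ↑s ⊆ W ∧ 8 ≤ s.card := by
  obtain ⟨x, -, hge, hle⟩ := exists_card_fiber h3 hprod hj
  obtain ⟨s, hsW, hs, -⟩ := exists_finset_rearrangements hW hχ x rfl
  refine ⟨s, hsW, ?_⟩
  rw [hs, Fintype.card_fin]
  exact eight_le_choose (by omega) hle

/-- If a value `x` is taken two to six times, the rearrangements alone suffice.  Otherwise `χ` is
`x` at seven places, and then it is `x⁻¹` at the eighth, so that the conjugate of `χ` takes the
value `x` exactly once: there are eight rearrangements of `χ` and eight other ones of its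
conjugate. -/
theorem exists_sixteen_rearrangements {W : Set (Fin 8 → ℂ)}
    (hW : ∀ χ ∈ W, ∀ σ : Equiv.Perm (Fin 8), χ ∘ σ ∈ W) (hstar : ∀ χ ∈ W, star χ ∈ W)
    {χ : Fin 8 → ℂ} (hχ : χ ∈ W) (h3 : ∀ i, χ i ^ 3 = 1) (hprod : ∏ i, χ i = 1)
    {j : Fin 8} (hj : χ j ≠ 1) : ∃ s : Finset (Fin 8 → ℂ), ↑s ⊆ W ∧ 16 ≤ s.card := by
  obtain ⟨x, hx3, hge, hle⟩ := exists_card_fiber h3 hprod hj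
  obtain ⟨s, hsW, hs, hsfib⟩ := exists_finset_rearrangements hW hχ x rfl
  rcases hle.lt_or_eq with hlt | h7
  · refine ⟨s, hsW, ?_⟩
    rw [hs, Fintype.card_fin]
    exact sixteen_le_choose (by omega) (by omega)
  have hstar_inv {z : ℂ} (hz : z ^ 3 = 1) : z * star z = 1 := by
    have : ‖z‖ = 1 := Complex.norm_eq_one_of_pow_eq_one hz (by norm_num)
    rw [Complex.star_def, Complex.mul_conj, Complex.normSq_eq_norm_sq, this]
    norm_num
  obtain ⟨m, hm⟩ : ∃ m, Finset.univ.filter (¬ χ · = x) = {m} := by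
    rw [← Finset.card_eq_one]
    have := Finset.card_filter_add_card_filter_not (s := Finset.univ) (χ · = x)
    rw [h7, Finset.card_univ, Fintype.card_fin] at this
    omega
  have hmx : χ m ≠ x := by
    have : m ∈ Finset.univ.filter (¬ χ · = x) := hm ▸ Finset.mem_singleton_self m
    simpa using this
  have hother {i : Fin 8} (hi : i ≠ m) : χ i = x := by
    by_contra h
    have : i ∈ Finset.univ.filter (¬ χ · = x) := by simpa using h
    exact hi (by simpa [hm] using this)
  -- The product of the values is `χ m * x ^ 7`, and `x ^ 6 = 1`.
  have hxm : χ m * x = 1 := by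
    rw [← Finset.mul_prod_erase _ _ (Finset.mem_univ m),
      Finset.prod_congr rfl fun i hi => hother (Finset.ne_of_mem_erase hi)] at hprod
    simp only [Finset.prod_const, Finset.card_erase_of_mem (Finset.mem_univ m), Finset.card_univ,
      Fintype.card_fin] at hprod
    linear_combination hprod - χ m * x * (x ^ 3 + 1) * hx3
  have hfib : (Finset.univ.filter ((star χ) · = x)).card = 1 := by
    refine Finset.card_eq_one.2 ⟨m, Finset.ext fun i => ?_⟩
    simp only [Finset.mem_filter, Finset.mem_univ, true_and, Finset.mem_singleton, Pi.star_apply]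
    constructor
    · intro h
      by_contra hi
      -- A cube root of unity equal to its conjugate is `1`, and then `χ m = x⁻¹` would be `x`.
      rw [hother hi] at h
      have hxx := hstar_inv hx3
      rw [h] at hxx
      have hx1 : x = 1 := by linear_combination hx3 - x * hxx
      exact hmx (by rw [hx1, mul_one] at hxm; rw [hxm, hx1])
    · rintro rfl
      exact mul_left_cancel₀ (left_ne_zero_of_mul_eq_one hxm) ((hstar_inv (h3 i)).trans hxm.symm)
  obtain ⟨t, htW, ht, htfib⟩ := exists_finset_rearrangements hW (hstar χ hχ) x hfib
  refine ⟨s ∪ t, by simp [hsW, htW], ?_⟩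
  have hdisj : Disjoint s t := by
    refine Finset.disjoint_left.2 fun ψ hψs hψt => ?_
    have := hsfib ψ hψs
    have := htfib ψ hψt
    omega
  rw [Finset.card_union_of_disjoint hdisj, hs, ht, h7]
  decide

/-! ### The weights of a representation of `ℤ_{3,0}^8 ⋊ S_8` -/

section TwistOp

variable {K V : Type*} [Field K] [AddCommGroup V] [Module K V]
  (ρ : Representation K (ZeroSumSemidirect 3 8) V)

/-- The operator by which the twist `twist i` acts in a representation. -/
def twistOp (i : Fin 8) : Module.End K V :=
  ρ (SemidirectProduct.inl (Multiplicative.ofAdd (twist i)))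

theorem commute_twistOp (i j : Fin 8) : Commute (twistOp ρ i) (twistOp ρ j) :=
  ((Commute.all (Multiplicative.ofAdd (twist i)) (Multiplicative.ofAdd (twist j))).map
    SemidirectProduct.inl).map ρ

theorem twistOp_pow_three (i : Fin 8) : twistOp ρ i ^ 3 = 1 := by
  have h : (Multiplicative.ofAdd (twist i)) ^ 3 = 1 := by
    refine Subtype.ext (funext fun j => ?_)
    change 3 • (twist i).1 j = 0
    revert i j
    decide
  rw [twistOp, ← map_pow, ← map_pow, h, map_one, map_one]

theorem twistOp_ne_one {ρ : Representation K (ZeroSumSemidirect 3 8) V}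
    (hρ : Function.Injective ρ) (i : Fin 8) : twistOp ρ i ≠ 1 := by
  intro h
  have h1 : SemidirectProduct.inl (Multiplicative.ofAdd (twist i)) = 1 :=
    hρ (h.trans (map_one ρ).symm)
  rw [map_eq_one_iff _ SemidirectProduct.inl_injective] at h1
  have h2 : (twist i).1 i = 0 := congrFun (congrArg Subtype.val h1) i
  clear h h1
  revert i
  decide

variable {ρ}

theorem prod_eq_one_of_mem_weights {χ : Fin 8 → K} (hχ : χ ∈ weights (twistOp ρ)) :
    ∏ i, χ i = 1 := by
  obtain ⟨v, hv0, hv⟩ := hχ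
  have h (s : Finset (Fin 8)) :
      ρ (SemidirectProduct.inl (Multiplicative.ofAdd (∑ i ∈ s, twist i))) v =
        (∏ i ∈ s, χ i) • v := by
    induction s using Finset.induction_on with
    | empty => simp
    | insert i s hi ih =>
      rw [Finset.sum_insert hi, ofAdd_add, map_mul, map_mul, Module.End.mul_apply, ih, map_smul,
        Finset.prod_insert hi, mul_comm, mul_smul]
      exact congrArg _ (hv i)
  have hsum : ∑ i, twist i = 0 := by
    refine Subtype.ext (funext fun j => ?_)
    rw [AddSubgroup.val_finsetSum, Finset.sum_apply]
    revert j
    decide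
  have h1 := h Finset.univ
  rw [hsum, ofAdd_zero, map_one, map_one, Module.End.one_apply] at h1
  exact (smul_left_injective K hv0 (by simpa using h1)).symm

/-- The weights of a representation of the semidirect product are permuted by `S_8`. -/
theorem comp_perm_mem_weights {χ : Fin 8 → K} (hχ : χ ∈ weights (twistOp ρ))
    (σ : Equiv.Perm (Fin 8)) : χ ∘ σ ∈ weights (twistOp ρ) := by
  obtain ⟨v, hv0, hv⟩ := hχ
  refine ⟨ρ (SemidirectProduct.inr σ⁻¹) v, fun h => hv0 ?_, fun i => ?_⟩
  · have h1 := congrArg (ρ (SemidirectProduct.inr σ)) h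
    rwa [← Module.End.mul_apply, ← map_mul, ← map_mul, mul_inv_cancel, map_one, map_one, map_zero,
      Module.End.one_apply] at h1
  · have hconj : (SemidirectProduct.inl (Multiplicative.ofAdd (twist i)) :
        ZeroSumSemidirect 3 8) * SemidirectProduct.inr σ⁻¹ =
        SemidirectProduct.inr σ⁻¹ * SemidirectProduct.inl (Multiplicative.ofAdd (twist (σ i))) := by
      have h1 := SemidirectProduct.inl_aut (φ := permAction 3 8) σ⁻¹
        (Multiplicative.ofAdd (twist (σ i)))
      rw [permAction_twist, Equiv.Perm.inv_def, Equiv.symm_apply_apply] at h1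
      rw [h1, mul_assoc, ← map_mul, ← Equiv.Perm.inv_def, inv_mul_cancel, map_one, mul_one]
    rw [twistOp, ← Module.End.mul_apply, ← map_mul, hconj, map_mul, Module.End.mul_apply]
    change ρ _ (twistOp ρ (σ i) v) = _
    rw [hv, map_smul]
    rfl

end TwistOp

/-! ### Lower bounds for the dimension of a faithful representation -/

theorem eight_le_finrank {V : Type*} [AddCommGroup V] [Module ℂ V] [FiniteDimensional ℂ V]
    {ρ : Representation ℂ (ZeroSumSemidirect 3 8) V} (hρ : Function.Injective ρ) :
    8 ≤ Module.finrank ℂ V := by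
  obtain ⟨χ, hχ, hχ0⟩ := exists_mem_weights_apply_ne_one (commute_twistOp ρ) three_ne_zero
    (twistOp_pow_three ρ) (twistOp_ne_one hρ 0)
  obtain ⟨s, hs, hcard⟩ := exists_eight_rearrangements
    (fun ψ hψ σ => comp_perm_mem_weights hψ σ) hχ
    (fun i => pow_eq_one_of_mem_weights hχ (twistOp_pow_three ρ i))
    (prod_eq_one_of_mem_weights hχ) hχ0
  exact hcard.trans (card_le_finrank_of_subset_weights (commute_twistOp ρ) s hs)

section Complexification

variable {G V : Type*} [Group G] [AddCommGroup V] [Module ℝ V]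

/-- The complexification of a real representation. -/
noncomputable def complexify (ρ : Representation ℝ G V) : Representation ℂ G (ℂ ⊗[ℝ] V) :=
  (Module.End.baseChangeHom ℝ ℂ V : Module.End ℝ V →* Module.End ℂ (ℂ ⊗[ℝ] V)).comp ρ

theorem complexify_apply (ρ : Representation ℝ G V) (g : G) :
    complexify ρ g = (ρ g).baseChange ℂ := rfl

theorem complexify_injective {ρ : Representation ℝ G V} (hρ : Function.Injective ρ) :
    Function.Injective (complexify ρ) :=
  (LinearMap.baseChangeHom_injective (R := ℝ) (S := ℂ) (M := V) (N := V)).comp hρ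

/-- Complex conjugation on the complexification `ℂ ⊗ V` of a real vector space. -/
noncomputable def conjTensor (V : Type*) [AddCommGroup V] [Module ℝ V] :
    (ℂ ⊗[ℝ] V) →ₗ[ℝ] ℂ ⊗[ℝ] V :=
  Complex.conjAe.toLinearMap.rTensor V

theorem conjTensor_smul (c : ℂ) (x : ℂ ⊗[ℝ] V) :
    conjTensor V (c • x) = star c • conjTensor V x := by
  induction x using TensorProduct.induction_on with
  | zero => simp
  | tmul z v => simp [conjTensor, TensorProduct.smul_tmul']
  | add x y hx hy => simp only [smul_add, map_add, hx, hy]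

theorem conjTensor_conjTensor (x : ℂ ⊗[ℝ] V) : conjTensor V (conjTensor V x) = x := by
  induction x using TensorProduct.induction_on with
  | zero => simp
  | tmul z v => simp [conjTensor]
  | add x y hx hy => simp only [map_add, hx, hy]

theorem conjTensor_complexify (ρ : Representation ℝ G V) (g : G) (x : ℂ ⊗[ℝ] V) :
    conjTensor V (complexify ρ g x) = complexify ρ g (conjTensor V x) := by
  induction x using TensorProduct.induction_on with
  | zero => simp
  | tmul z v => simp [conjTensor, complexify_apply]
  | add x y hx hy => simp only [map_add, hx, hy]

end Complexification

theorem star_mem_weights {V : Type*} [AddCommGroup V] [Module ℝ V]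
    (ρ : Representation ℝ (ZeroSumSemidirect 3 8) V) {χ : Fin 8 → ℂ}
    (hχ : χ ∈ weights (twistOp (complexify ρ))) : star χ ∈ weights (twistOp (complexify ρ)) := by
  obtain ⟨v, hv0, hv⟩ := hχ
  refine ⟨conjTensor V v, fun h => hv0 ?_, fun i => ?_⟩
  · rw [← conjTensor_conjTensor v, h, map_zero]
  · rw [Pi.star_apply, ← conjTensor_smul, ← hv, twistOp, conjTensor_complexify]

theorem sixteen_le_finrank {V : Type*} [AddCommGroup V] [Module ℝ V] [FiniteDimensional ℝ V]
    {ρ : Representation ℝ (ZeroSumSemidirect 3 8) V} (hρ : Function.Injective ρ) :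
    16 ≤ Module.finrank ℝ V := by
  have hc := commute_twistOp (complexify ρ)
  obtain ⟨χ, hχ, hχ0⟩ := exists_mem_weights_apply_ne_one hc three_ne_zero
    (twistOp_pow_three _) (twistOp_ne_one (complexify_injective hρ) 0)
  obtain ⟨s, hs, hcard⟩ := exists_sixteen_rearrangements
    (fun ψ hψ σ => comp_perm_mem_weights hψ σ) (fun ψ hψ => star_mem_weights ρ hψ) hχ
    (fun i => pow_eq_one_of_mem_weights hχ (twistOp_pow_three _ i))
    (prod_eq_one_of_mem_weights hχ) hχ0
  rw [← Module.finrank_baseChange (R := ℂ)]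
  exact hcard.trans (card_le_finrank_of_subset_weights hc s hs)

/-! ### The monomial representation -/

theorem monomialRep_injective (k m : ℕ) [NeZero k] : Function.Injective (monomialRep k m) := by
  intro g h hgh
  have key (v : Fin m → ℂ) (j : Fin m) :
      ZMod.stdAddChar ((Multiplicative.toAdd g.left).1 j) * v (g.right⁻¹ j) =
        ZMod.stdAddChar ((Multiplicative.toAdd h.left).1 j) * v (h.right⁻¹ j) :=
    congrFun (congr($hgh v)) j
  have hright : g.right = h.right := by
    refine inv_injective (Equiv.ext fun j => ?_)
    -- Testing on a basis vector recovers the permutation, as no entry of the diagonal vanishes.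
    have h1 := key (Pi.single (g.right⁻¹ j) 1) j
    by_contra hne
    rw [Pi.single_eq_same, Pi.single_eq_of_ne (Ne.symm hne), mul_one, mul_zero] at h1
    exact ((ZMod.stdAddChar (N := k)).val_isUnit _).ne_zero h1
  refine SemidirectProduct.ext (Subtype.ext (funext fun j => ?_)) hright
  have h1 := key 1 j
  simp only [Pi.one_apply, mul_one] at h1
  exact ZMod.injective_stdAddChar h1

theorem restrictToReal_injective {G V : Type} [Group G] [AddCommGroup V] [Module ℂ V] [Module ℝ V]
    [IsScalarTower ℝ ℂ V] {ρ : Representation ℂ G V} (hρ : Function.Injective ρ) :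
    Function.Injective (restrictToReal ρ) :=
  fun _ _ hgh => hρ (LinearMap.ext fun v => congr($hgh v))

end Rubik

theorem mainTheorem2 :
    (∃ e : Rubik.G₂ ≃* Rubik.ZeroSumSemidirect 3 8,
      (∀ (g : Rubik.G₂) (s : Rubik.Sticker), (g.1 s).1 = (e g).right s.1) ∧
      Function.Injective ((Rubik.monomialRep 3 8).comp e.toMonoidHom) ∧
      Function.Injective
        (Rubik.restrictToReal ((Rubik.monomialRep 3 8).comp e.toMonoidHom)) ∧
      Module.finrank ℂ (Fin 8 → ℂ) = 8 ∧
      Module.finrank ℝ (Fin 8 → ℂ) = 16) ∧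
    IsLeast (Rubik.faithfulDims ℂ Rubik.G₂) 8 ∧
    IsLeast (Rubik.faithfulDims ℝ Rubik.G₂) 16 := by
  have hinj : Function.Injective
      ((Rubik.monomialRep 3 8).comp Rubik.cubeEquiv.toMonoidHom) :=
    (Rubik.monomialRep_injective 3 8).comp Rubik.cubeEquiv.injective
  have hC : Module.finrank ℂ (Fin 8 → ℂ) = 8 := by simp
  have hR : Module.finrank ℝ (Fin 8 → ℂ) = 16 := by
    simp [Module.finrank_pi_fintype, Complex.finrank_real_complex]
  refine ⟨⟨Rubik.cubeEquiv, Rubik.cubeEquiv_right, hinj, Rubik.restrictToReal_injective hinj, hC,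
    hR⟩, ⟨⟨_, _, _, inferInstance, _, hinj, hC⟩, ?_⟩,
    ⟨⟨_, _, _, inferInstance, _, Rubik.restrictToReal_injective hinj, hR⟩, ?_⟩⟩
  · rintro n ⟨V, _, _, _, ρ, hρ, rfl⟩
    exact Rubik.eight_le_finrank (ρ := ρ.comp Rubik.cubeEquiv.symm.toMonoidHom)
      (hρ.comp Rubik.cubeEquiv.symm.injective)
  · rintro n ⟨V, _, _, _, ρ, hρ, rfl⟩
    exact Rubik.sixteen_le_finrank (ρ := ρ.comp Rubik.cubeEquiv.symm.toMonoidHom)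
      (hρ.comp Rubik.cubeEquiv.symm.injective)
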